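/- **Theorem.** Let $A$ be a commutative ring with identity, let $\underline a=(a_1,\dots,a_r)$ be a finite sequence of elements of $A$ ($r\ge 0$), and let $I=(a_1,\dots,a_r)$. Then $\underline a$ is weakly proregular if and only if, for every $i\ge 0$ and every $A$-module $M$, there is an isomorphism of $A$-modules $H^i_I(M)\cong \check H^i(\underline a,M)$. Moreover, if $\underline a$ is weakly proregular, then for every $i\ge 0$ these isomorphisms can be chosen functorially in $M$, i.e. $H^i_I(-)\cong\check H^i(\underline a,-)$ as functors. Here the notions are the following. * $H^i_I(-)$ (local cohomology) is the $i$-th right derived functor of $\Gamma_I$, where $\Gamma_I(M)=\{x\in M : I^n x=0 \text{ for some } n\ge 0\}$. * For $s=\{j_1<\dots<j_i\}\subseteq\{1,\dots,r\}$ put $a_s=a_{j_1}\cdots a_{j_i}$ (so $a_\emptyset=1$) and $e_s=e_{j_1}\wedge\dots\wedge e_{j_i}$. The Čech complex $C^\bullet(\underline a)$ has $C^i(\underline a)=\bigoplus_{\#s=i}A_{a_s}e_s$ and differential $e_s\mapsto\sum_{j=1}^r e_s\wedge e_j$ (using the canonical maps between the localizations), and $\check H^i(\underline a,M)=H^i(C^\bullet(\underline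 a)\otimes_A M)$. * The Koszul complex $K_\bullet(\underline a)$ has $K_i(\underline a)=\bigwedge^i A^r$, with basis the $e_s$, $\#s=i$, and differential $e_{j_1}\wedge\dots\wedge e_{j_i}\mapsto\sum_{p=1}^i(-1)^{p+1}a_{j_p}\,e_{j_1}\wedge\dots\wedge\widehat{e_{j_p}}\wedge\dots\wedge e_{j_i}$; write $H_i(\underline a)$ for its homology and $\underline a^n=(a_1^n,\dots,a_r^n)$. For $m\ge n$ the map $e_s\mapsto a_s^{m-n}e_s$ is a morphism of complexes $K_\bullet(\underline a^m)\to K_\bullet(\underline a^n)$. * $\underline a$ is weakly proregular if for every $1\le i\le r$ and every $n>0$ there is $m\ge n$ such that the induced map $H_i(\underline a^m)\to H_i(\underline a^n)$ is zero. -/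

import Mathlib

open CategoryTheory TensorProduct

universe u

/-! ### Local cohomology -/

noncomputable section

namespace LocalCoh

variable {A : Type u} [CommRing A]

/-- `Γ_I(M) = {x ∈ M | I ^ n x = 0 for some n ≥ 0}`. -/
def gammaSubmodule (I : Ideal A) (M : Type u) [AddCommGroup M] [Module A M] : Submodule A M where
  carrier := {x | ∃ n : ℕ, ∀ b ∈ I ^ n, b • x = 0}
  zero_mem' := ⟨0, fun b _ => smul_zero b⟩
  add_mem' := by
    rintro x y ⟨n, hn⟩ ⟨m, hm⟩
    refine ⟨n + m, fun b hb => ?_⟩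
    rw [smul_add, hn b (Ideal.pow_le_pow_right (Nat.le_add_right n m) hb),
      hm b (Ideal.pow_le_pow_right (Nat.le_add_left m n) hb), add_zero]
  smul_mem' := by
    rintro c x ⟨n, hn⟩
    refine ⟨n, fun b hb => ?_⟩
    rw [smul_comm, hn b hb, smul_zero]

/-- The map `Γ_I(M) → Γ_I(N)` obtained by restricting an `A`-linear map `M → N`. -/
def gammaMap (I : Ideal A) {M N : Type u} [AddCommGroup M] [Module A M] [AddCommGroup N]
    [Module A N] (f : M →ₗ[A] N) : gammaSubmodule I M →ₗ[A] gammaSubmodule I N :=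
  f.restrict (by
    rintro x ⟨n, hn⟩
    refine ⟨n, fun b hb => ?_⟩
    rw [← map_smul, hn b hb, map_zero])

/-- The `I`-torsion functor `Γ_I` on `A`-modules. -/
def gammaFunctor (I : Ideal A) : ModuleCat.{u} A ⥤ ModuleCat.{u} A where
  obj M := ModuleCat.of A (gammaSubmodule I M)
  map f := ModuleCat.ofHom (gammaMap I f.hom)
  map_id _ := rfl
  map_comp _ _ := rfl

instance gammaFunctor_additive (I : Ideal A) : (gammaFunctor I).Additive where
  map_add := rfl

/-- Local cohomology `H^i_I`: the `i`-th right derived functor of `Γ_I`. -/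
def H (I : Ideal A) (i : ℕ) : ModuleCat.{u} A ⥤ ModuleCat.{u} A :=
  (gammaFunctor I).rightDerived i

end LocalCoh

end

/-! ### Index sets and signs for the Koszul and Čech complexes -/

/-- The subsets of `{1, …, r}` with exactly `i` elements. -/
abbrev Subsets (r i : ℕ) : Type := {s : Finset (Fin r) // s.card = i}

/-- Remove an element `j` from a subset with `i + 1` elements. -/
def Subsets.erase {r i : ℕ} (s : Subsets r (i + 1)) (j : {j : Fin r // j ∈ s.1}) : Subsets r i :=
  ⟨s.1.erase j.1, by rw [Finset.card_erase_of_mem j.2, s.2, Nat.add_sub_cancel]⟩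

lemma Subsets.erase_subset {r i : ℕ} (s : Subsets r (i + 1)) (j : {j : Fin r // j ∈ s.1}) :
    (s.erase j).1 ⊆ s.1 := Finset.erase_subset j.1 s.1

/-- The number of elements of `s` smaller than `j`: this is the sign exponent when `e_j` is moved
to the front of `e_s`. -/
def countBelow {r : ℕ} (s : Finset (Fin r)) (j : Fin r) : ℕ := (s.filter (fun k => k < j)).card

/-- The number of elements of `s` larger than `j`: the sign exponent when `e_j` is moved to the
end of `e_s`, so that `e_{s \ {j}} ∧ e_j = (-1) ^ (countAbove s j) • e_s` for `j ∈ s`. -/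
def countAbove {r : ℕ} (s : Finset (Fin r)) (j : Fin r) : ℕ := (s.filter (fun k => j < k)).card

lemma countBelow_erase {r : ℕ} (s : Finset (Fin r)) {j k : Fin r} (hj : j ∈ s) (h : j < k) :
    countBelow s k = countBelow (s.erase j) k + 1 ∧ countBelow (s.erase k) j = countBelow s j := by
  unfold countBelow
  constructor
  · rw [Finset.filter_erase, Finset.card_erase_add_one]
    simp [hj, h]
  · rw [Finset.filter_erase, Finset.erase_eq_of_notMem]
    simp [h.le]

lemma countAbove_erase {r : ℕ} (s : Finset (Fin r)) {j k : Fin r} (hk : k ∈ s) (h : j < k) :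
    countAbove s j = countAbove (s.erase k) j + 1 ∧ countAbove (s.erase j) k = countAbove s k := by
  unfold countAbove
  constructor
  · rw [Finset.filter_erase, Finset.card_erase_add_one]
    simp [hk, h]
  · rw [Finset.filter_erase, Finset.erase_eq_of_notMem]
    simp [h.le]

/-- The cancellation behind `d ∘ d = 0`. -/
lemma sum_erase_erase {r i : ℕ} {A N : Type*} [CommRing A] [AddCommGroup N] [Module A N]
    (s : Subsets r (i + 1 + 1)) (ε : Finset (Fin r) → Fin r → ℕ)
    (hε : ∀ j ∈ s.1, ∀ k ∈ s.1, j ≠ k →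
      ((-1 : A) ^ ε s.1 j * (-1) ^ ε (s.1.erase j) k) =
        -((-1 : A) ^ ε s.1 k * (-1) ^ ε (s.1.erase k) j))
    (F : ∀ (j : {j : Fin r // j ∈ s.1}), {k : Fin r // k ∈ (s.erase j).1} → N)
    (hF : ∀ j k (hj : j ∈ s.1) (hk : k ∈ s.1) (hjk : j ≠ k),
      F ⟨j, hj⟩ ⟨k, Finset.mem_erase.2 ⟨hjk.symm, hk⟩⟩ =
        F ⟨k, hk⟩ ⟨j, Finset.mem_erase.2 ⟨hjk, hj⟩⟩) :
    ∑ j : {j : Fin r // j ∈ s.1}, ∑ k : {k : Fin r // k ∈ (s.erase j).1},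
      ((-1 : A) ^ ε s.1 j.1 * (-1) ^ ε (s.erase j).1 k.1) • F j k = 0 := by
  rw [← Fintype.sum_sigma
    (fun x : (j : {j : Fin r // j ∈ s.1}) × {k : Fin r // k ∈ (s.erase j).1} =>
      ((-1 : A) ^ ε s.1 x.1.1 * (-1) ^ ε (s.erase x.1).1 x.2.1) • F x.1 x.2)]
  refine Finset.sum_involution
    (fun x _ => ⟨⟨x.2.1, (Finset.mem_erase.1 x.2.2).2⟩,
      ⟨x.1.1, Finset.mem_erase.2 ⟨(Finset.mem_erase.1 x.2.2).1.symm, x.1.2⟩⟩⟩) ?_ ?_ ?_ ?_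
  · rintro ⟨⟨j, hj⟩, ⟨k, hk⟩⟩ -
    have hk' := Finset.mem_erase.1 hk
    have e := hF j k hj hk'.2 hk'.1.symm
    have e2 := hε j hj k hk'.2 hk'.1.symm
    dsimp only [Subsets.erase] at e e2 ⊢
    rw [e, e2, ← add_smul, neg_add_cancel, zero_smul]
  · rintro ⟨⟨j, hj⟩, ⟨k, hk⟩⟩ - - h
    have hk' := Finset.mem_erase.1 hk
    exact hk'.1 (congrArg (fun x => x.1.1) h)
  · intros; exact Finset.mem_univ _
  · intros; rfl

lemma neg_one_pow_countBelow {r : ℕ} {A : Type*} [CommRing A] (s : Finset (Fin r)) (j : Fin r)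
    (hj : j ∈ s) (k : Fin r) (hk : k ∈ s) (h : j ≠ k) :
    ((-1 : A) ^ countBelow s j * (-1) ^ countBelow (s.erase j) k) =
      -((-1 : A) ^ countBelow s k * (-1) ^ countBelow (s.erase k) j) := by
  rcases lt_or_gt_of_ne h with h | h
  · obtain ⟨h1, h2⟩ := countBelow_erase s hj h
    rw [h1, h2]; ring
  · obtain ⟨h1, h2⟩ := countBelow_erase s hk h
    rw [h1, h2]; ring

lemma neg_one_pow_countAbove {r : ℕ} {A : Type*} [CommRing A] (s : Finset (Fin r)) (j : Fin r)
    (hj : j ∈ s) (k : Fin r) (hk : k ∈ s) (h : j ≠ k) :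
    ((-1 : A) ^ countAbove s j * (-1) ^ countAbove (s.erase j) k) =
      -((-1 : A) ^ countAbove s k * (-1) ^ countAbove (s.erase k) j) := by
  rcases lt_or_gt_of_ne h with h | h
  · obtain ⟨h1, h2⟩ := countAbove_erase s hk h
    rw [h1, h2]; ring
  · obtain ⟨h1, h2⟩ := countAbove_erase s hj h
    rw [h1, h2]; ring

noncomputable section

/-! ### The Koszul complex and weakly proregular sequences -/

namespace Koszul

variable {A : Type u} [CommRing A] {r : ℕ}

/-- `K_i = ⋀^i A^r`, the free `A`-module on the `e_s = e_{j_1} ∧ ⋯ ∧ e_{j_i}`, where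
`s = {j_1 < ⋯ < j_i}` runs over the subsets of `{1, …, r}` with `i` elements. -/
abbrev Obj (A : Type u) [CommRing A] (r i : ℕ) : Type u := Subsets r i →₀ A

/-- The Koszul differential: for `s = {j_1 < ⋯ < j_{i+1}}`, `e_s` is sent to
`∑ p, (-1) ^ (p + 1) a_{j_p} e_{s \ {j_p}}`. -/
def d (a : Fin r → A) (i : ℕ) : Obj A r (i + 1) →ₗ[A] Obj A r i :=
  Finsupp.linearCombination A fun s : Subsets r (i + 1) =>
    ∑ j : {j : Fin r // j ∈ s.1},
      ((-1) ^ countBelow s.1 j.1 * a j.1) • Finsupp.single (s.erase j) (1 : A)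

lemma d_single (a : Fin r → A) (i : ℕ) (s : Subsets r (i + 1)) :
    d a i (Finsupp.single s 1) = ∑ j : {j : Fin r // j ∈ s.1},
      ((-1) ^ countBelow s.1 j.1 * a j.1) • Finsupp.single (s.erase j) (1 : A) := by
  rw [d, Finsupp.linearCombination_single, one_smul]

lemma d_comp_d (a : Fin r → A) (i : ℕ) : d a i ∘ₗ d a (i + 1) = 0 := by
  refine Finsupp.lhom_ext' fun s => LinearMap.ext_ring ?_
  simp only [LinearMap.comp_apply, Finsupp.lsingle_apply, d_single, map_sum, map_smul,
    Finset.smul_sum, smul_smul, LinearMap.zero_apply]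
  rw [← sum_erase_erase (A := A) s countBelow (neg_one_pow_countBelow s.1)
    (fun j k => (a j.1 * a k.1) • Finsupp.single ((s.erase j).erase k) (1 : A))]
  · refine Finset.sum_congr rfl fun j _ => Finset.sum_congr rfl fun k _ => ?_
    rw [smul_smul]
    congr 1
    ring
  · intro j k hj hk hjk
    simp only [Subsets.erase, mul_comm (a j), Finset.erase_right_comm (a := j)]

/-- The Koszul complex `K_•(a)`. -/
def complex (a : Fin r → A) : ChainComplex (ModuleCat.{u} A) ℕ :=
  ChainComplex.of (fun i => ModuleCat.of A (Obj A r i)) (fun i => ModuleCat.ofHom (d a i))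
    (fun i => by rw [← ModuleCat.ofHom_comp, d_comp_d]; rfl)

lemma complex_d (a : Fin r → A) (i : ℕ) :
    (complex a).d (i + 1) i = ModuleCat.ofHom (d a i) :=
  ChainComplex.of_d (fun i => ModuleCat.of A (Obj A r i)) (fun i => ModuleCat.ofHom (d a i)) i

/-- The map `K_i(a^m) → K_i(a^n)`, `e_s ↦ a_s ^ (m - n) e_s` with `a_s = ∏ j ∈ s, a_j`. -/
def transition (a : Fin r → A) (m n i : ℕ) : Obj A r i →ₗ[A] Obj A r i :=
  Finsupp.linearCombination A fun s : Subsets r i =>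
    Finsupp.single s ((∏ j ∈ s.1, a j) ^ (m - n))

lemma transition_comm (a : Fin r → A) {m n : ℕ} (h : n ≤ m) (i : ℕ) :
    d (fun j => a j ^ n) i ∘ₗ transition a m n (i + 1) =
      transition a m n i ∘ₗ d (fun j => a j ^ m) i := by
  refine Finsupp.lhom_ext' fun s => LinearMap.ext_ring ?_
  have hs : ∀ (i : ℕ) (t : Subsets r i) (c : A),
      Finsupp.single t c = c • Finsupp.single t (1 : A) := by simp
  simp only [LinearMap.comp_apply, Finsupp.lsingle_apply, d_single, map_sum, map_smul, transition,
    Finsupp.linearCombination_single, one_smul]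
  rw [hs _ s, map_smul, d_single, Finset.smul_sum]
  refine Finset.sum_congr rfl fun j _ => ?_
  rw [hs _ (s.erase j) (_ ^ _), smul_smul, smul_smul]
  congr 1
  have h1 : ∏ k ∈ s.1, a k = a j.1 * ∏ k ∈ (s.erase j).1, a k :=
    (Finset.mul_prod_erase s.1 a j.2).symm
  have h2 : a j.1 ^ m = a j.1 ^ (m - n) * a j.1 ^ n := by rw [← pow_add, Nat.sub_add_cancel h]
  rw [h1, h2]
  ring

/-- The morphism of complexes `K_•(a^m) → K_•(a^n)` for `n ≤ m`, where
`a^n = (a_1 ^ n, …, a_r ^ n)`. -/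
def transitionHom (a : Fin r → A) {m n : ℕ} (h : n ≤ m) :
    complex (fun j => a j ^ m) ⟶ complex (fun j => a j ^ n) :=
  ChainComplex.ofHom (fun i => ModuleCat.ofHom (transition a m n i)) (fun i => by
    rw [complex_d, complex_d]
    exact congrArg ModuleCat.ofHom (transition_comm a h i))

end Koszul

/-- `a` is weakly proregular if for every `1 ≤ i ≤ r` the projective system of Koszul homology
modules `H_i(a^n)` is essentially zero: for each `n > 0` there is `m ≥ n` such that
`H_i(a^m) → H_i(a^n)` is the zero map. -/
def IsWeaklyProregular {A : Type u} [CommRing A] {r : ℕ} (a : Fin r → A) : Prop :=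
  ∀ i : ℕ, 1 ≤ i → i ≤ r → ∀ n : ℕ, 0 < n → ∃ (m : ℕ) (h : n ≤ m),
    HomologicalComplex.homologyMap (Koszul.transitionHom a h) i = 0

/-! ### The Čech complex and Čech cohomology -/

namespace Cech

variable {A : Type u} [CommRing A] {r : ℕ}

/-- The localization `A_{a_s}`, where `a_s = ∏ j ∈ s, a_j`. -/
abbrev Loc (a : Fin r → A) (s : Finset (Fin r)) : Type u := Localization.Away (∏ j ∈ s, a j)

/-- The canonical map `A_{a_s} → A_{a_t}` for `s ⊆ t`. -/
def res (a : Fin r → A) {s t : Finset (Fin r)} (h : s ⊆ t) : Loc a s →ₐ[A] Loc a t :=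
  IsLocalization.Away.liftAlgHom (S := Loc a s) (∏ j ∈ s, a j) (f := Algebra.ofId A (Loc a t))
    (isUnit_of_dvd_unit
      (map_dvd (algebraMap A (Loc a t)) (Finset.prod_dvd_prod_of_subset s t a h))
      (IsLocalization.Away.algebraMap_isUnit (∏ j ∈ t, a j)))

lemma res_res (a : Fin r → A) {s t u : Finset (Fin r)} (h : s ⊆ t) (h' : t ⊆ u) (x : Loc a s) :
    res a h' (res a h x) = res a (h.trans h') x :=
  DFunLike.congr_fun ((IsLocalization.algHom_subsingleton (R := A)
    (Submonoid.powers (∏ j ∈ s, a j))).elim ((res a h').comp (res a h)) (res a (h.trans h'))) x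

/-- `C^i(a) = ⨁_{#s = i} A_{a_s} e_s`. -/
abbrev Obj (a : Fin r → A) (i : ℕ) : Type u := ∀ s : Subsets r i, Loc a s.1

/-- The Čech differential `e_s ↦ ∑ j, e_s ∧ e_j`. The `t`-component of the image of `x` collects
the contributions of the sets `s = t \ {j}` with `j ∈ t`. -/
def d (a : Fin r → A) (i : ℕ) : Obj a i →ₗ[A] Obj a (i + 1) :=
  LinearMap.pi fun t : Subsets r (i + 1) => ∑ j : {j : Fin r // j ∈ t.1},
    ((-1 : A) ^ countAbove t.1 j.1) •
      ((res a (t.erase_subset j)).toLinearMap ∘ₗ LinearMap.proj (t.erase j))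

lemma d_apply (a : Fin r → A) (i : ℕ) (x : Obj a i) (t : Subsets r (i + 1)) :
    d a i x t = ∑ j : {j : Fin r // j ∈ t.1}, ((-1 : A) ^ countAbove t.1 j.1) •
      res a (t.erase_subset j) (x (t.erase j)) := by
  rw [d, LinearMap.pi_apply, LinearMap.sum_apply]
  rfl

lemma d_comp_d (a : Fin r → A) (i : ℕ) : d a (i + 1) ∘ₗ d a i = 0 := by
  refine LinearMap.ext fun x => funext fun t => ?_
  have hx : ∀ (s s' : Subsets r i) (hs : s.1 ⊆ t.1) (hs' : s'.1 ⊆ t.1), s = s' →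
      res a hs (x s) = res a hs' (x s') := by
    rintro s _ _ _ rfl
    rfl
  simp only [LinearMap.comp_apply, LinearMap.zero_apply, Pi.zero_apply]
  rw [d_apply, ← sum_erase_erase (A := A) t countAbove (neg_one_pow_countAbove t.1)
    (fun j k => res a (((t.erase j).erase_subset k).trans (t.erase_subset j))
      (x ((t.erase j).erase k)))]
  · refine Finset.sum_congr rfl fun j _ => ?_
    rw [d_apply, map_sum, Finset.smul_sum]
    refine Finset.sum_congr rfl fun k _ => ?_
    rw [map_smul, smul_smul]
    congr 1
    exact res_res a _ _ _
  · intro j k hj hk hjk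
    exact hx _ _ _ _ (Subtype.ext (Finset.erase_right_comm))

/-- The complex `C^•(a, M) = C^•(a) ⊗ M`. -/
def complex (a : Fin r → A) (M : ModuleCat.{u} A) : CochainComplex (ModuleCat.{u} A) ℕ :=
  CochainComplex.of (fun i => ModuleCat.of A (Obj a i ⊗[A] M))
    (fun i => ModuleCat.ofHom ((d a i).rTensor M))
    (fun i => by rw [← ModuleCat.ofHom_comp, ← LinearMap.rTensor_comp, d_comp_d,
      LinearMap.rTensor_zero]; rfl)

lemma complex_d (a : Fin r → A) (M : ModuleCat.{u} A) (i : ℕ) :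
    (complex a M).d i (i + 1) = ModuleCat.ofHom ((d a i).rTensor M) :=
  CochainComplex.of_d (fun i => ModuleCat.of A (Obj a i ⊗[A] M))
    (fun i => ModuleCat.ofHom ((d a i).rTensor M)) i

/-- The functor `M ↦ C^•(a, M)`. -/
def complexFunctor (a : Fin r → A) : ModuleCat.{u} A ⥤ CochainComplex (ModuleCat.{u} A) ℕ where
  obj M := complex a M
  map {M N} f := CochainComplex.ofHom (X := complex a M) (Y := complex a N)
    (fun i => ModuleCat.ofHom (f.hom.lTensor (Obj a i))) (fun i => by
      rw [complex_d, complex_d]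
      exact congrArg ModuleCat.ofHom
        ((LinearMap.rTensor_comp_lTensor _ (d a i) f.hom).trans
          (LinearMap.lTensor_comp_rTensor _ (d a i) f.hom).symm))
  map_id M := HomologicalComplex.hom_ext _ _ fun i =>
    congrArg ModuleCat.ofHom (LinearMap.lTensor_id (Obj a i) M)
  map_comp f g := HomologicalComplex.hom_ext _ _ fun i =>
    congrArg ModuleCat.ofHom (LinearMap.lTensor_comp (Obj a i) g.hom f.hom)

/-- Čech cohomology `Ȟ^i(a, -)`, as a functor of the module. -/
def H (a : Fin r → A) (i : ℕ) : ModuleCat.{u} A ⥤ ModuleCat.{u} A :=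
  complexFunctor a ⋙ HomologicalComplex.homologyFunctor _ _ i

end Cech

end

/-! Write C(M) for the Čech complex of M. Both implications pass through one condition, (E):
H^{i+1}(C(J)) = 0 for every injective J and every i ≥ 0.

(E) is equivalent to agreement with local cohomology. Since localizations are flat, C is an exact
functor, and H^0(C(M)) is Γ_I(M) (`gammaIso`). Under (E) the functors H^i ∘ C are effaced by
injectives, so dimension shifting along injective resolutions identifies them naturally with the
derived functors of H^0 ∘ C (`nonempty_rightDerived_iso`). Conversely, derived functors vanish on
injectives in positive degrees, so isomorphisms chosen separately for each module already force (E).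

(E) is equivalent to weak proregularity. Clearing denominators presents C(M), up to signs, as the
filtered colimit over n of Hom(K(a^n), M) (`d_ofKoszul`, `exists_ofKoszul_eq`,
`exists_comp_transition_eq_zero`). If J is injective, a map killing the cycles factors through the
differential and extends, so essentially zero Koszul homology makes the colimit acyclic in positive
degrees (`exact_of_isWeaklyProregular`). Conversely, embed K_i(a^n) modulo boundaries in an
injective J. The tautological cocycle becomes a coboundary at some higher level, hence kills cycles
there; so those cycles map to boundaries at level n (`isWeaklyProregular_of_exact`). -/

noncomputable section

/-! ### Derived functors from effaceable cohomology -/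

namespace RightDerivedComparison

open Limits HomologicalComplex

/-! ### Naturality squares obtained by cancelling an epi or a mono -/

section Squares

variable {D : Type*} [Category* D] {X X' Y Y' Z Z' T T' : D}

lemma comp_iso_of_epi {p : X ⟶ Y} {p' : X' ⟶ Y'} {e : Y ≅ Z} {e' : Y' ≅ Z'} {g : X ⟶ Z}
    {g' : X' ⟶ Z'} {a : X ⟶ X'} {b : Y ⟶ Y'} {c : Z ⟶ Z'} (hp : Epi p) (h : p ≫ e.hom = g)
    (h' : p' ≫ e'.hom = g') (hb : a ≫ p' = p ≫ b) (hc : g ≫ c = a ≫ g') :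
    b ≫ e'.hom = e.hom ≫ c := by
  rw [← cancel_epi p, reassoc_of% h, hc, ← reassoc_of% hb, h']

lemma comp_iso_inv_of_mono {e : X ≅ Y} {e' : X' ≅ Y'} {m : Y ⟶ Z} {m' : Y' ⟶ Z'} {g : X ⟶ Z}
    {g' : X' ⟶ Z'} {a : X ⟶ X'} {b : Y ⟶ Y'} {c : Z ⟶ Z'} (hm : Mono m') (h : e.hom ≫ m = g)
    (h' : e'.hom ≫ m' = g') (hb : b ≫ m' = m ≫ c) (hc : g ≫ c = a ≫ g') :
    b ≫ e'.inv = e.inv ≫ a := by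
  rw [Iso.comp_inv_eq, Category.assoc, Iso.eq_inv_comp, ← cancel_mono m', Category.assoc, hb,
    reassoc_of% h, hc, Category.assoc, h']

lemma comp_lift_of_mono {p : X ⟶ Y} {p' : X' ⟶ Y'} {m : Y ⟶ Z} {m' : Y' ⟶ Z'} {g : X ⟶ Z}
    {g' : X' ⟶ Z'} {a : X ⟶ X'} {b : Y ⟶ Y'} {c : Z ⟶ Z'} (hm : Mono m') (h : p ≫ m = g)
    (h' : p' ≫ m' = g') (hb : b ≫ m' = m ≫ c) (hc : a ≫ g' = g ≫ c) : a ≫ p' = p ≫ b := by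
  rw [← cancel_mono m', Category.assoc, h', hc, Category.assoc, hb, reassoc_of% h]

lemma comp_two_squares {a : X ⟶ X'} {b : Y ⟶ Y'} {c : Z ⟶ Z'} {i : X ⟶ Y} {i' : X' ⟶ Y'}
    {j : Y ⟶ Z} {j' : Y' ⟶ Z'} (h₁ : a ≫ i' = i ≫ b) (h₂ : b ≫ j' = j ≫ c) :
    a ≫ i' ≫ j' = (i ≫ j) ≫ c := by
  rw [reassoc_of% h₁, h₂, Category.assoc]

lemma comp_three_squares {a : X ⟶ X'} {b : Y ⟶ Y'} {c : Z ⟶ Z'} {d : T ⟶ T'} {i : X ⟶ Y}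
    {i' : X' ⟶ Y'} {j : Y ⟶ Z} {j' : Y' ⟶ Z'} {k : Z ⟶ T} {k' : Z' ⟶ T'} (h₁ : a ≫ i' = i ≫ b)
    (h₂ : b ≫ j' = j ≫ c) (h₃ : c ≫ k' = k ≫ d) : a ≫ i' ≫ j' ≫ k' = (i ≫ j ≫ k) ≫ d := by
  rw [reassoc_of% h₁, reassoc_of% h₂, h₃, Category.assoc, Category.assoc]

end Squares

variable {C D : Type*} [Category* C] [Category* D] [Abelian C] [Abelian D]

/-- The sequence `Z^q(K) ⟶ K^q ⟶ Z^{q+1}(K)`. -/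
abbrev cyclesSeq (K : CochainComplex C ℕ) (q : ℕ) : ShortComplex C :=
  ShortComplex.mk (K.iCycles q) (K.toCycles q (q + 1)) (by
    rw [← cancel_mono (K.iCycles (q + 1))]; simp)

/-- The map induced on `cyclesSeq` by a morphism of complexes. -/
abbrev cyclesSeqMap {K L : CochainComplex C ℕ} (φ : K ⟶ L) (q : ℕ) :
    cyclesSeq K q ⟶ cyclesSeq L q where
  τ₁ := cyclesMap φ q
  τ₂ := φ.f q
  τ₃ := cyclesMap φ (q + 1)
  comm₂₃ := by
    rw [← cancel_mono (L.iCycles (q + 1))]; simp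

/-- Only surjectivity needs the hypothesis: the cokernel of K^q ⟶ Z^{q+1} is H^{q+1}(K). -/
lemma cyclesSeq_shortExact (K : CochainComplex C ℕ) (q : ℕ) (h : K.ExactAt (q + 1)) :
    (cyclesSeq K q).ShortExact where
  exact := by
    refine ShortComplex.exact_of_f_is_kernel _ ?_
    refine KernelFork.IsLimit.ofι' _ _ fun k hk => ?_
    have hk' : k ≫ K.d q (q + 1) = 0 := by
      have := hk =≫ K.iCycles (q + 1)
      rwa [Category.assoc, zero_comp, toCycles_i] at this
    exact ⟨K.liftCycles k (q + 1) (by simp) hk', K.liftCycles_i k (q + 1) (by simp) hk'⟩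
  mono_f := by dsimp; infer_instance
  epi_g := by
    have h0 : K.homologyπ (q + 1) = 0 := h.isZero_homology.eq_of_tgt _ _
    have hc := K.homologyIsCokernel q (q + 1) (by simp)
    refine Preadditive.epi_of_cancel_zero _ fun {Y} g hg => ?_
    obtain ⟨l, hl⟩ := CokernelCofork.IsColimit.desc' hc g hg
    rw [← hl]
    dsimp
    rw [h0, zero_comp]

/-! ### Dimension shifting for an exact functor to complexes -/

variable (G : C ⥤ CochainComplex D ℕ) [G.Additive]
  (hG : ∀ S : ShortComplex C, S.ShortExact → (S.map G).ShortExact)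

/-- The connecting map `H^p(G(Z^{q+1})) ⟶ H^{p+1}(G(Z^q))`. -/
def δ (K : CochainComplex C ℕ) (hK : ∀ n, K.ExactAt (n + 1)) (p q : ℕ) :
    (G.obj (K.cycles (q + 1))).homology p ⟶ (G.obj (K.cycles q)).homology (p + 1) :=
  (hG _ (cyclesSeq_shortExact K q (hK q))).δ p (p + 1) (by simp)

lemma δ_naturality {K L : CochainComplex C ℕ} (hK : ∀ n, K.ExactAt (n + 1))
    (hL : ∀ n, L.ExactAt (n + 1)) (φ : K ⟶ L) (p q : ℕ) :
    δ G hG K hK p q ≫ homologyMap (G.map (cyclesMap φ q)) (p + 1) =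
      homologyMap (G.map (cyclesMap φ (q + 1))) p ≫ δ G hG L hL p q :=
  HomologySequence.δ_naturality (G.mapShortComplex.map (cyclesSeqMap φ q)) _ _ p (p + 1) (by simp)

/-- The iterated connecting map `H^p(G(Z^q)) ⟶ H^{p+q}(G(Z^0))`. -/
def iterδ (K : CochainComplex C ℕ) (hK : ∀ n, K.ExactAt (n + 1)) :
    ∀ q p n : ℕ, p + q = n →
      ((G.obj (K.cycles q)).homology p ⟶ (G.obj (K.cycles 0)).homology n)
  | 0, _, _, h => eqToHom (by subst h; rfl)
  | q + 1, p, n, h => δ G hG K hK p q ≫ iterδ K hK q (p + 1) n (by omega)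

lemma iterδ_naturality {K L : CochainComplex C ℕ} (hK : ∀ n, K.ExactAt (n + 1))
    (hL : ∀ n, L.ExactAt (n + 1)) (φ : K ⟶ L) (q p n : ℕ) (h : p + q = n) :
    iterδ G hG K hK q p n h ≫ homologyMap (G.map (cyclesMap φ 0)) n =
      homologyMap (G.map (cyclesMap φ q)) p ≫ iterδ G hG L hL q p n h := by
  induction q generalizing p with
  | zero => subst h; simp [iterδ]
  | succ q ih =>
    rw [iterδ, iterδ, Category.assoc, ih, ← Category.assoc, δ_naturality G hG hK hL φ p q,
      Category.assoc]

/-- Starting in degree at least 1, each connecting map lies between cohomology groups of G(K^q) in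
positive degrees, which vanish. In degree 0 the first map is only an epimorphism, as in `epi_iterδ`.
-/
lemma isIso_iterδ (K : CochainComplex C ℕ) (hK : ∀ n, K.ExactAt (n + 1))
    (hv : ∀ q i, IsZero ((G.obj (K.X q)).homology (i + 1))) (q p n : ℕ) (h : p + 1 + q = n) :
    IsIso (iterδ G hG K hK q (p + 1) n h) := by
  induction q generalizing p with
  | zero => rw [iterδ]; infer_instance
  | succ q ih =>
    have : IsIso (δ G hG K hK (p + 1) q) :=
      (hG _ (cyclesSeq_shortExact K q (hK q))).isIso_δ _ _ _ (hv q p) (hv q (p + 1))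
    have := ih (p + 1) (by omega)
    rw [iterδ]
    infer_instance

/-- `H^0 ∘ G`. -/
abbrev zeroth : C ⥤ D := G ⋙ homologyFunctor D _ 0

include hG in
-- Left exactness of H^0: the long exact sequence begins in degree 0, as no differential enters that
-- degree.
lemma preservesFiniteLimits_zeroth : PreservesFiniteLimits (zeroth G) := by
  refine ((zeroth G).preservesFiniteLimits_tfae.out 0 3).1 ?_
  intro S hS
  refine ⟨?_, ?_⟩
  · exact (hG S hS).homology_exact₂ 0
  · have := (hG S hS).mono_f
    have : Mono ((G.map S.f).f 0) := inferInstanceAs (Mono ((S.map G).f.f 0))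
    exact mono_homologyMap_of_mono_of_not_rel (G.map S.f) 0 (by simp)

lemma zeroth_comp_δ (K : CochainComplex C ℕ) (hK : ∀ n, K.ExactAt (n + 1)) (q : ℕ) :
    homologyMap (G.map (K.toCycles q (q + 1))) 0 ≫ δ G hG K hK 0 q = 0 :=
  (hG _ (cyclesSeq_shortExact K q (hK q))).comp_δ 0 (0 + 1) (by simp)

lemma exact_zeroth_δ (K : CochainComplex C ℕ) (hK : ∀ n, K.ExactAt (n + 1)) (q : ℕ) :
    (ShortComplex.mk _ _ (zeroth_comp_δ G hG K hK q)).Exact :=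
  (hG _ (cyclesSeq_shortExact K q (hK q))).homology_exact₃ 0 (0 + 1) (by simp)

lemma zeroth_comp_iterδ (K : CochainComplex C ℕ) (hK : ∀ n, K.ExactAt (n + 1)) (q : ℕ) :
    homologyMap (G.map (K.toCycles q (q + 1))) 0 ≫ iterδ G hG K hK (q + 1) 0 (q + 1) (by simp) = 0 := by
  rw [iterδ, ← Category.assoc, zeroth_comp_δ, zero_comp]

lemma exact_zeroth_iterδ (K : CochainComplex C ℕ) (hK : ∀ n, K.ExactAt (n + 1))
    (hv : ∀ q i, IsZero ((G.obj (K.X q)).homology (i + 1))) (q : ℕ) :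
    (ShortComplex.mk _ _ (zeroth_comp_iterδ G hG K hK q)).Exact := by
  have := isIso_iterδ G hG K hK hv q 0 (q + 1) (by omega)
  let e := ShortComplex.isoMk (S₁ := ShortComplex.mk _ _ (zeroth_comp_δ G hG K hK q))
    (S₂ := ShortComplex.mk _ _ (zeroth_comp_iterδ G hG K hK q)) (Iso.refl _) (Iso.refl _)
    (asIso (iterδ G hG K hK q (0 + 1) (q + 1) _))
    ((Category.id_comp _).trans (Category.comp_id _).symm)
    (Category.id_comp _)
  exact (ShortComplex.exact_iff_of_iso e).1 (exact_zeroth_δ G hG K hK q)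

lemma epi_iterδ (K : CochainComplex C ℕ) (hK : ∀ n, K.ExactAt (n + 1))
    (hv : ∀ q i, IsZero ((G.obj (K.X q)).homology (i + 1))) (q : ℕ) :
    Epi (iterδ G hG K hK (q + 1) 0 (q + 1) (by simp)) := by
  have := isIso_iterδ G hG K hK hv q 0 (q + 1) (by omega)
  have : Epi (δ G hG K hK 0 q) :=
    (hG _ (cyclesSeq_shortExact K q (hK q))).epi_δ 0 (0 + 1) (by simp) (hv q 0)
  rw [iterδ]
  exact epi_comp _ _

/-! ### Cohomology of F(K) for a left exact functor F -/

section LeftExact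

variable (F : C ⥤ D) [F.Additive]

/-- The image under `F` of a complex. -/
abbrev mapComplex (K : CochainComplex C ℕ) : CochainComplex D ℕ :=
  (F.mapHomologicalComplex _).obj K

/-- The image under `F` of the inclusion `Z^n(K) ⟶ K^n`. -/
def mapICycles (K : CochainComplex C ℕ) (n : ℕ) : F.obj (K.cycles n) ⟶ (mapComplex F K).X n :=
  F.map (K.iCycles n)

/-- The image under `F` of the map `K^q ⟶ Z^{q+1}(K)`. -/
def mapToCycles (K : CochainComplex C ℕ) (q : ℕ) :
    (mapComplex F K).X q ⟶ F.obj (K.cycles (q + 1)) :=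
  F.map (K.toCycles q (q + 1))

lemma mapICycles_d (K : CochainComplex C ℕ) (n : ℕ) :
    mapICycles F K n ≫ (mapComplex F K).d n (n + 1) = 0 :=
  (F.map_comp _ _).symm.trans (by rw [iCycles_d]; exact F.map_zero _ _)

lemma mapToCycles_mapICycles (K : CochainComplex C ℕ) (q : ℕ) :
    mapToCycles F K q ≫ mapICycles F K (q + 1) = (mapComplex F K).d q (q + 1) :=
  (F.map_comp _ _).symm.trans (by rw [toCycles_i]; rfl)

lemma map_cyclesMap_mapICycles {K L : CochainComplex C ℕ} (φ : K ⟶ L) (n : ℕ) :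
    F.map (cyclesMap φ n) ≫ mapICycles F L n =
      mapICycles F K n ≫ ((F.mapHomologicalComplex _).map φ).f n :=
  (F.map_comp _ _).symm.trans (by rw [cyclesMap_i, F.map_comp]; rfl)

/-- `F(Z^n(K))` is the kernel of `F(K^n) ⟶ F(K^{n+1})`. -/
def mapICyclesIsLimit [PreservesFiniteLimits F] (K : CochainComplex C ℕ) (n : ℕ) :
    IsLimit (KernelFork.ofι (mapICycles F K n) (mapICycles_d F K n)) :=
  KernelFork.mapIsLimit _ (K.cyclesIsKernel n (n + 1) (by simp)) F

/-- The canonical map `F(Z^n(K)) ⟶ Z^n(F(K))`. -/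
def toCyclesMap (K : CochainComplex C ℕ) (n : ℕ) :
    F.obj (K.cycles n) ⟶ (mapComplex F K).cycles n :=
  (mapComplex F K).liftCycles (mapICycles F K n) (n + 1) (by simp) (mapICycles_d F K n)

lemma toCyclesMap_iCycles (K : CochainComplex C ℕ) (n : ℕ) :
    toCyclesMap F K n ≫ (mapComplex F K).iCycles n = mapICycles F K n :=
  liftCycles_i _ _ _ _ _

lemma toCyclesMap_naturality {K L : CochainComplex C ℕ} (φ : K ⟶ L) (n : ℕ) :
    F.map (cyclesMap φ n) ≫ toCyclesMap F L n =
      toCyclesMap F K n ≫ cyclesMap ((F.mapHomologicalComplex _).map φ) n := by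
  rw [← cancel_mono ((mapComplex F L).iCycles n), Category.assoc, Category.assoc,
    toCyclesMap_iCycles, cyclesMap_i, reassoc_of% toCyclesMap_iCycles F K n, map_cyclesMap_mapICycles]

instance isIso_toCyclesMap [PreservesFiniteLimits F] (K : CochainComplex C ℕ) (n : ℕ) :
    IsIso (toCyclesMap F K n) := by
  have h1 := mapICyclesIsLimit F K n
  have h2 := (mapComplex F K).cyclesIsKernel n (n + 1) (by simp)
  have : toCyclesMap F K n = (IsLimit.conePointUniqueUpToIso h1 h2).hom := by
    rw [← cancel_mono ((mapComplex F K).iCycles n), toCyclesMap_iCycles]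
    exact (IsLimit.conePointUniqueUpToIso_hom_comp h1 h2 WalkingParallelPair.zero).symm
  rw [this]
  infer_instance

/-- The canonical map `F(Z^n(K)) ⟶ H^n(F(K))`. -/
def toHomology (K : CochainComplex C ℕ) (n : ℕ) :
    F.obj (K.cycles n) ⟶ (mapComplex F K).homology n :=
  toCyclesMap F K n ≫ (mapComplex F K).homologyπ n

lemma toHomology_naturality {K L : CochainComplex C ℕ} (φ : K ⟶ L) (n : ℕ) :
    F.map (cyclesMap φ n) ≫ toHomology F L n =
      toHomology F K n ≫ homologyMap ((F.mapHomologicalComplex _).map φ) n := by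
  rw [toHomology, toHomology, ← Category.assoc, toCyclesMap_naturality, Category.assoc,
    Category.assoc, homologyπ_naturality]

instance epi_toHomology [PreservesFiniteLimits F] (K : CochainComplex C ℕ) (n : ℕ) :
    Epi (toHomology F K n) := epi_comp _ _

lemma mapToCycles_comp_toCyclesMap (K : CochainComplex C ℕ) (q : ℕ) :
    mapToCycles F K q ≫ toCyclesMap F K (q + 1) = (mapComplex F K).toCycles q (q + 1) := by
  rw [← cancel_mono ((mapComplex F K).iCycles (q + 1)), Category.assoc, toCyclesMap_iCycles,
    toCycles_i, mapToCycles_mapICycles]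

lemma mapToCycles_comp_toHomology (K : CochainComplex C ℕ) (q : ℕ) :
    mapToCycles F K q ≫ toHomology F K (q + 1) = 0 := by
  rw [toHomology, ← Category.assoc, mapToCycles_comp_toCyclesMap, toCycles_comp_homologyπ]

/-- H^{q+1}(F(K)) is the cokernel of F(K^q) ⟶ Z^{q+1}(F(K)), and left exactness replaces the target
by F(Z^{q+1}(K)). -/
lemma exact_toHomology [PreservesFiniteLimits F] (K : CochainComplex C ℕ) (q : ℕ) :
    (ShortComplex.mk _ _ (mapToCycles_comp_toHomology F K q)).Exact := by
  have h : (ShortComplex.mk _ _ ((mapComplex F K).toCycles_comp_homologyπ q (q + 1))).Exact :=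
    ShortComplex.exact_of_g_is_cokernel _ ((mapComplex F K).homologyIsCokernel q (q + 1) (by simp))
  let e := ShortComplex.isoMk (S₁ := ShortComplex.mk _ _ (mapToCycles_comp_toHomology F K q))
    (S₂ := ShortComplex.mk _ _ ((mapComplex F K).toCycles_comp_homologyπ q (q + 1)))
    (Iso.refl _) (asIso (toCyclesMap F K (q + 1))) (Iso.refl _)
    ((Category.id_comp _).trans (mapToCycles_comp_toCyclesMap F K q).symm)
    (Category.comp_id _).symm
  exact (ShortComplex.exact_iff_of_iso e).2 h

end LeftExact

/-- Two epimorphisms out of `X` with the same kernel (the image of `f`) have isomorphic targets. -/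
lemma exists_iso_of_exact {W X Y Y' : D} {f : W ⟶ X} {p : X ⟶ Y} {p' : X ⟶ Y'} (hp : Epi p) (hp' : Epi p')
    {w : f ≫ p = 0} {w' : f ≫ p' = 0} (h : (ShortComplex.mk f p w).Exact)
    (h' : (ShortComplex.mk f p' w').Exact) : ∃ e : Y ≅ Y', p ≫ e.hom = p' := by
  have : Epi (ShortComplex.mk f p w).g := hp
  have : Epi (ShortComplex.mk f p' w').g := hp'
  exact ⟨h.gIsCokernel.coconePointUniqueUpToIso h'.gIsCokernel,
    IsColimit.comp_coconePointUniqueUpToIso_hom h.gIsCokernel h'.gIsCokernel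
      WalkingParallelPair.one⟩

/-- The isomorphism `Z ≅ Z^0` attached to an injective resolution. -/
lemma exists_iso_cycles_zero {Z : C} (P : InjectiveResolution Z) :
    ∃ e : Z ≅ P.cocomplex.cycles 0, e.hom ≫ P.cocomplex.iCycles 0 = P.ι.f 0 := by
  have h2 := P.cocomplex.cyclesIsKernel 0 1 (by simp)
  exact ⟨P.isLimitKernelFork.conePointUniqueUpToIso h2,
    IsLimit.conePointUniqueUpToIso_hom_comp P.isLimitKernelFork h2 WalkingParallelPair.zero⟩

variable [HasInjectiveResolutions C]

include hG in
/-- Comparison of the derived functors of `H^0 ∘ G` with the functors `H^i ∘ G`, when `G` is exact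
and `H^{i+1} ∘ G` vanishes on injectives. -/
theorem nonempty_rightDerived_iso
    (hv : ∀ (J : C) [Injective J] (i : ℕ), IsZero ((G.obj J).homology (i + 1))) (i : ℕ) :
    Nonempty ((zeroth G).rightDerived i ≅ G ⋙ homologyFunctor D _ i) := by
  have := preservesFiniteLimits_zeroth G hG
  cases i with
  | zero => exact ⟨(zeroth G).rightDerivedZeroIsoSelf⟩
  | succ q =>
    let P : ∀ Z : C, InjectiveResolution Z := fun Z => injectiveResolution Z
    have hK : ∀ Z n, (P Z).cocomplex.ExactAt (n + 1) := fun Z => (P Z).cocomplex_exactAt_succ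
    have hv' : ∀ Z n i, IsZero ((G.obj ((P Z).cocomplex.X n)).homology (i + 1)) :=
      fun Z n i => hv _ i
    have hepi := fun Z => epi_iterδ G hG (P Z).cocomplex (hK Z) (hv' Z) q
    -- With F = H^0 ∘ G and K the resolution of Z, both H^{q+1}(F(K)) and H^{q+1}(G(Z^0(K))) are
    -- cokernels of F(K^q) ⟶ F(Z^{q+1}(K)).
    choose e he using fun Z => exists_iso_of_exact (epi_toHomology _ _ _) (hepi Z)
      (exact_toHomology (zeroth G) (P Z).cocomplex q)
      (exact_zeroth_iterδ G hG (P Z).cocomplex (hK Z) (hv' Z) q)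
    choose c hc using fun Z => exists_iso_cycles_zero (P Z)
    refine ⟨NatIso.ofComponents (fun Z => (P Z).isoRightDerivedObj (zeroth G) (q + 1) ≪≫ e Z ≪≫
      (G ⋙ homologyFunctor D _ (q + 1)).mapIso (c Z).symm) fun {X Y} f => ?_⟩
    let φ := InjectiveResolution.desc f (P Y) (P X)
    have comm : (P X).ι.f 0 ≫ φ.f 0 = f ≫ (P Y).ι.f 0 :=
      InjectiveResolution.desc_commutes_zero f _ _
    have h1 := InjectiveResolution.isoRightDerivedObj_hom_naturality f (P X) (P Y) φ comm
      (zeroth G) (q + 1)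
    -- `e` is determined by its composite with an epimorphism, so its naturality follows from that
    -- of `toHomology` and `iterδ`.
    have h2 := comp_iso_of_epi (epi_toHomology _ _ _) (he X) (he Y)
      (toHomology_naturality (zeroth G) φ (q + 1))
      (iterδ_naturality G hG (hK X) (hK Y) φ (q + 1) 0 (q + 1) (by simp))
    have h3 := comp_iso_inv_of_mono (inferInstanceAs (Mono ((P Y).cocomplex.iCycles 0))) (hc X) (hc Y)
      (cyclesMap_i φ 0) comm
    have h4 := congrArg (G ⋙ homologyFunctor D _ (q + 1)).map h3
    rw [Functor.map_comp, Functor.map_comp] at h4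
    exact comp_three_squares h1 h2 h4

end RightDerivedComparison

end

noncomputable section

/-! ### Čech cochains as fractions of Koszul cochains -/

namespace Cech

variable {A : Type u} [CommRing A] {r : ℕ} (a : Fin r → A)
variable {M : Type u} [AddCommGroup M] [Module A M]

/-- The fraction `x / a_s ^ n`, as an element of `A_{a_s} ⊗ M`. -/
def frac (s : Finset (Fin r)) (n : ℕ) : M →ₗ[A] Loc a s ⊗[A] M :=
  TensorProduct.mk A (Loc a s) M (IsLocalization.Away.invSelf (∏ j ∈ s, a j) ^ n)

lemma pow_smul_invSelf (s : Finset (Fin r)) (n k : ℕ) :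
    (∏ j ∈ s, a j) ^ k • (IsLocalization.Away.invSelf (∏ j ∈ s, a j) : Loc a s) ^ (n + k) =
      IsLocalization.Away.invSelf (∏ j ∈ s, a j) ^ n := by
  rw [Algebra.smul_def, map_pow, pow_add, mul_left_comm, ← mul_pow,
    IsLocalization.Away.mul_invSelf, one_pow, mul_one]

lemma frac_add (s : Finset (Fin r)) (n k : ℕ) (x : M) :
    frac a s (n + k) ((∏ j ∈ s, a j) ^ k • x) = frac a s n x := by
  rw [frac, TensorProduct.mk_apply, ← TensorProduct.smul_tmul, pow_smul_invSelf]
  rfl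

lemma pow_smul_frac (s : Finset (Fin r)) (n : ℕ) (x : M) :
    (∏ j ∈ s, a j) ^ n • frac a s n x = 1 ⊗ₜ x := by
  have := frac_add a s 0 n x
  rw [map_smul, zero_add] at this
  rw [this, frac, pow_zero, TensorProduct.mk_apply]

/-- A_{a_s} ⊗ M is the localization of M at the powers of a_s, and x / a_s^n = 0 forces x / 1 = 0.
-/
lemma exists_pow_smul_eq_zero (s : Finset (Fin r)) (n : ℕ) (x : M) (h : frac a s n x = 0) :
    ∃ k, (∏ j ∈ s, a j) ^ k • x = 0 := by
  have h1 : TensorProduct.mk A (Loc a s) M 1 x = 0 := by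
    rw [TensorProduct.mk_apply, ← pow_smul_frac a s n, h, smul_zero]
  obtain ⟨⟨_, k, rfl⟩, hk⟩ := (IsLocalizedModule.eq_zero_iff (Submonoid.powers (∏ j ∈ s, a j))
    (TensorProduct.mk A (Loc a s) M 1)).1 h1
  exact ⟨k, hk⟩

/-- Every large exponent is allowed, so that finitely many fractions can later share one exponent.
-/
lemma exists_frac_eq (s : Finset (Fin r)) (y : Loc a s ⊗[A] M) :
    ∃ n₀ : ℕ, ∀ n, n₀ ≤ n → ∃ x, frac a s n x = y := by
  obtain ⟨⟨x, ⟨_, n₀, rfl⟩⟩, rfl⟩ := IsLocalizedModule.mk'_surjective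
    (Submonoid.powers (∏ j ∈ s, a j)) (TensorProduct.mk A (Loc a s) M 1) y
  refine ⟨n₀, fun n hn => ?_⟩
  obtain ⟨k, rfl⟩ := Nat.exists_eq_add_of_le hn
  refine ⟨(∏ j ∈ s, a j) ^ k • x, ?_⟩
  rw [frac_add]
  refine ((IsLocalizedModule.mk'_eq_iff (S := Submonoid.powers (∏ j ∈ s, a j))
    (f := TensorProduct.mk A (Loc a s) M 1)).2 ?_).symm
  exact (pow_smul_frac a s n₀ x).symm

/-- This is 1 / a_s = a_{t \ s} / a_t, checked after multiplying by the unit a_t. -/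
lemma res_invSelf {s t : Finset (Fin r)} (h : s ⊆ t) :
    res a h (IsLocalization.Away.invSelf (∏ j ∈ s, a j)) =
      (∏ j ∈ t \ s, a j) • IsLocalization.Away.invSelf (∏ j ∈ t, a j) := by
  have hu := IsLocalization.Away.algebraMap_isUnit (S := Loc a t) (∏ j ∈ t, a j)
  have h1 := IsLocalization.Away.mul_invSelf (S := Loc a s) (∏ j ∈ s, a j)
  have h2 := IsLocalization.Away.mul_invSelf (S := Loc a t) (∏ j ∈ t, a j)
  have h3 := congrArg (res a h) h1
  rw [map_mul, map_one, AlgHom.commutes] at h3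
  have h4 : algebraMap A (Loc a t) (∏ j ∈ t, a j) =
      algebraMap A (Loc a t) (∏ j ∈ t \ s, a j) * algebraMap A (Loc a t) (∏ j ∈ s, a j) := by
    rw [← map_mul, Finset.prod_sdiff h]
  rw [← hu.mul_right_inj, Algebra.smul_def, mul_left_comm, h2, mul_one, h4, mul_assoc, h3, mul_one]

lemma res_frac {s t : Finset (Fin r)} (h : s ⊆ t) (n : ℕ) (x : M) :
    (res a h).toLinearMap.rTensor M (frac a s n x) =
      frac a t n ((∏ j ∈ t \ s, a j) ^ n • x) := by
  rw [frac, frac, TensorProduct.mk_apply, TensorProduct.mk_apply, LinearMap.rTensor_tmul,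
    AlgHom.toLinearMap_apply, map_pow, res_invSelf, smul_pow, TensorProduct.smul_tmul]

/-- The components of an element of `C^i(a) ⊗ M`. -/
def components (i : ℕ) (M : Type u) [AddCommGroup M] [Module A M] :
    Obj a i ⊗[A] M ≃ₗ[A] ∀ s : Subsets r i, Loc a s.1 ⊗[A] M :=
  TensorProduct.piLeft ..

lemma components_tmul (i : ℕ) (x : Obj a i) (m : M) (s : Subsets r i) :
    components a i M (x ⊗ₜ m) s = x s ⊗ₜ m := rfl

lemma components_d (i : ℕ) (z : Obj a i ⊗[A] M) (t : Subsets r (i + 1)) :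
    components a (i + 1) M ((d a i).rTensor M z) t =
      ∑ j : {j : Fin r // j ∈ t.1}, ((-1 : A) ^ countAbove t.1 j.1) •
        (res a (t.erase_subset j)).toLinearMap.rTensor M (components a i M z (t.erase j)) := by
  induction z with
  | zero => simp
  | add z w hz hw => simp only [map_add, Pi.add_apply, hz, hw, smul_add, Finset.sum_add_distrib]
  | tmul x m =>
    rw [LinearMap.rTensor_tmul, components_tmul, d_apply, TensorProduct.sum_tmul]
    rfl

/-- The Čech cochain `(φ(e_s) / a_s ^ n)_s` attached to a Koszul cochain `φ`. -/
def ofKoszul (n i : ℕ) (M : Type u) [AddCommGroup M] [Module A M] :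
    (Koszul.Obj A r i →ₗ[A] M) →ₗ[A] Obj a i ⊗[A] M :=
  (components a i M).symm.toLinearMap ∘ₗ LinearMap.pi fun s =>
    frac a s.1 n ∘ₗ LinearMap.applyₗ (Finsupp.single s 1)

lemma components_ofKoszul (n i : ℕ) (φ : Koszul.Obj A r i →ₗ[A] M) (s : Subsets r i) :
    components a i M (ofKoszul a n i M φ) s = frac a s.1 n (φ (Finsupp.single s 1)) := by
  rw [ofKoszul, LinearMap.comp_apply, LinearEquiv.coe_coe, LinearEquiv.apply_symm_apply]
  rfl

lemma countAbove_add_countBelow (s : Finset (Fin r)) {j : Fin r} (hj : j ∈ s) :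
    countAbove s j + countBelow s j + 1 = s.card := by
  rw [countAbove, countBelow, ← Finset.card_erase_add_one hj, ← Finset.card_union_of_disjoint]
  · congr 2
    ext k
    simp only [Finset.mem_union, Finset.mem_filter, Finset.mem_erase]
    constructor
    · rintro (⟨h, h'⟩ | ⟨h, h'⟩)
      · exact ⟨h'.ne', h⟩
      · exact ⟨h'.ne, h⟩
    · rintro ⟨h, h'⟩
      rcases lt_or_gt_of_ne h with h | h
      · exact Or.inr ⟨h', h⟩
      · exact Or.inl ⟨h', h⟩
  · rw [Finset.disjoint_filter]
    exact fun _ _ h h' => lt_asymm h h'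

/-- The Čech sign moves e_j to the end and the Koszul sign moves it to the front; the discrepancy
depends only on the degree. -/
lemma neg_one_pow_countAbove_eq {i : ℕ} (t : Subsets r (i + 1)) (j : {j : Fin r // j ∈ t.1}) :
    (-1 : A) ^ countAbove t.1 j.1 = (-1) ^ i * (-1) ^ countBelow t.1 j.1 := by
  have h := countAbove_add_countBelow t.1 j.2
  rw [t.2, Nat.add_right_cancel_iff] at h
  have h' : (-1 : A) ^ countAbove t.1 j.1 =
      (-1) ^ (countAbove t.1 j.1 + countBelow t.1 j.1) * (-1) ^ countBelow t.1 j.1 := by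
    rw [pow_add, mul_assoc, ← mul_pow, neg_one_mul, neg_neg, one_pow, mul_one]
  rw [h', h]

/-- Up to sign, `ofKoszul` commutes with the differentials. -/
lemma d_ofKoszul (n i : ℕ) (φ : Koszul.Obj A r i →ₗ[A] M) :
    (d a i).rTensor M (ofKoszul a n i M φ) =
      (-1 : A) ^ i • ofKoszul a n (i + 1) M (φ ∘ₗ Koszul.d (fun j => a j ^ n) i) := by
  refine (components a (i + 1) M).injective (funext fun t => ?_)
  rw [components_d, map_smul, Pi.smul_apply, components_ofKoszul, LinearMap.comp_apply,
    Koszul.d_single, map_sum, map_sum, Finset.smul_sum]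
  refine Finset.sum_congr rfl fun j _ => ?_
  have h : ∏ k ∈ t.1 \ (t.erase j).1, a k = a j.1 := by
    have : t.1 \ (t.erase j).1 = {j.1} := by
      ext k
      simp only [Subsets.erase, Finset.mem_sdiff, Finset.mem_erase, Finset.mem_singleton]
      constructor
      · rintro ⟨h, h'⟩
        by_contra hk
        exact h' ⟨hk, h⟩
      · rintro rfl
        exact ⟨j.2, fun h => h.1 rfl⟩
    rw [this, Finset.prod_singleton]
  -- Passing from denominator a_{t \ {j}}^n to a_t^n costs a factor a_j^n, which is the Koszul
  -- coefficient for a^n.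
  rw [components_ofKoszul, res_frac, h, neg_one_pow_countAbove_eq]
  simp only [map_smul, smul_smul, mul_assoc]

lemma transition_single (m n i : ℕ) (s : Subsets r i) :
    Koszul.transition a m n i (Finsupp.single s 1) =
      (∏ j ∈ s.1, a j) ^ (m - n) • Finsupp.single s (1 : A) := by
  rw [Koszul.transition, Finsupp.linearCombination_single, one_smul, Finsupp.smul_single,
    smul_eq_mul, mul_one]

lemma ofKoszul_transition {m n : ℕ} (h : n ≤ m) (i : ℕ) (φ : Koszul.Obj A r i →ₗ[A] M) :
    ofKoszul a m i M (φ ∘ₗ Koszul.transition a m n i) = ofKoszul a n i M φ := by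
  refine (components a i M).injective (funext fun s => ?_)
  obtain ⟨k, rfl⟩ := Nat.exists_eq_add_of_le h
  rw [components_ofKoszul, components_ofKoszul, LinearMap.comp_apply, transition_single,
    LinearMap.map_smul φ, Nat.add_sub_cancel_left]
  exact frac_add a s.1 n k _

/-- Surjectivity half of the colimit description: there are finitely many components, so take a
common exponent. -/
lemma exists_ofKoszul_eq (i : ℕ) (z : Obj a i ⊗[A] M) :
    ∃ n₀ : ℕ, ∀ n, n₀ ≤ n →
      ∃ φ : Koszul.Obj A r i →ₗ[A] M, ofKoszul a n i M φ = z := by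
  choose n₀ h using fun s : Subsets r i => exists_frac_eq a s.1 (components a i M z s)
  refine ⟨Finset.univ.sup n₀, fun n hn => ?_⟩
  choose x hx using fun s : Subsets r i => h s n ((Finset.le_sup (Finset.mem_univ s)).trans hn)
  refine ⟨Finsupp.linearCombination A x, (components a i M).injective (funext fun s => ?_)⟩
  rw [components_ofKoszul, Finsupp.linearCombination_single, one_smul, hx]

/-- Injectivity half of the colimit description: a cochain that dies in the Čech complex already
dies at a finite level. -/
lemma exists_comp_transition_eq_zero (n i : ℕ) (φ : Koszul.Obj A r i →ₗ[A] M)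
    (h : ofKoszul a n i M φ = 0) :
    ∃ m₀ : ℕ, ∀ m, m₀ ≤ m → φ ∘ₗ Koszul.transition a m n i = 0 := by
  have h' (s : Subsets r i) : ∃ k, (∏ j ∈ s.1, a j) ^ k • φ (Finsupp.single s 1) = 0 := by
    refine exists_pow_smul_eq_zero a s.1 n _ ?_
    rw [← components_ofKoszul, h, map_zero, Pi.zero_apply]
  choose k hk using h'
  refine ⟨n + Finset.univ.sup k, fun m hm => Finsupp.lhom_ext' fun s => LinearMap.ext_ring ?_⟩
  have hks : k s ≤ m - n := (Finset.le_sup (Finset.mem_univ s)).trans (by omega)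
  obtain ⟨l, hl⟩ := Nat.exists_eq_add_of_le hks
  rw [LinearMap.comp_apply, LinearMap.comp_apply, Finsupp.lsingle_apply, transition_single,
    map_smul, hl, add_comm, pow_add, mul_smul, hk, smul_zero]
  rfl

end Cech

end

noncomputable section

/-! ### Weak proregularity and Čech cohomology of injective modules -/

variable {A : Type u} [CommRing A] {r : ℕ} (a : Fin r → A)

namespace Koszul

lemma homologyMap_eq_zero_iff {K L : ChainComplex (ModuleCat.{u} A) ℕ} (f : K ⟶ L) (i : ℕ) :
    HomologicalComplex.homologyMap f (i + 1) = 0 ↔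
      ∀ x, K.d (i + 1) i x = 0 → ∃ y, L.d (i + 1 + 1) (i + 1) y = f.f (i + 1) x := by
  have hL : (ShortComplex.mk _ _ (L.toCycles_comp_homologyπ (i + 1 + 1) (i + 1))).Exact :=
    ShortComplex.exact_of_g_is_cokernel _ (L.homologyIsCokernel (i + 1 + 1) (i + 1) (by simp))
  have hK : (ShortComplex.mk _ _ (K.iCycles_d (i + 1) i)).Exact :=
    ShortComplex.exact_of_f_is_kernel _ (K.cyclesIsKernel (i + 1) i (by simp))
  rw [ShortComplex.moduleCat_exact_iff] at hL hK
  have hinj : Function.Injective (L.iCycles (i + 1)) :=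
    (ModuleCat.mono_iff_injective _).1 inferInstance
  have hi (z) : L.iCycles (i + 1) (HomologicalComplex.cyclesMap f (i + 1) z) =
      f.f (i + 1) (K.iCycles (i + 1) z) :=
    ConcreteCategory.congr_hom (HomologicalComplex.cyclesMap_i f (i + 1)) z
  have ht (y) : L.iCycles (i + 1) (L.toCycles (i + 1 + 1) (i + 1) y) =
      L.d (i + 1 + 1) (i + 1) y :=
    ConcreteCategory.congr_hom (L.toCycles_i (i + 1 + 1) (i + 1)) y
  rw [← cancel_epi (K.homologyπ (i + 1)), Limits.comp_zero,
    HomologicalComplex.homologyπ_naturality]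
  constructor
  · intro h x hx
    obtain ⟨z, hz⟩ := hK x hx
    obtain ⟨y, hy⟩ := hL (HomologicalComplex.cyclesMap f (i + 1) z)
      (ConcreteCategory.congr_hom h z)
    refine ⟨y, ?_⟩
    rw [← ht, ← hz]
    exact (congrArg (L.iCycles (i + 1)) hy).trans (hi z)
  · intro h
    ext z
    obtain ⟨y, hy⟩ := h (K.iCycles (i + 1) z)
      (ConcreteCategory.congr_hom (K.iCycles_d (i + 1) i) z)
    have : HomologicalComplex.cyclesMap f (i + 1) z = L.toCycles (i + 1 + 1) (i + 1) y :=
      hinj (by rw [hi, ht, hy])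
    refine (congrArg (L.homologyπ (i + 1)) this).trans ?_
    exact ConcreteCategory.congr_hom (L.toCycles_comp_homologyπ (i + 1 + 1) (i + 1)) y

lemma homologyMap_transition_eq_zero_iff {m n : ℕ} (h : n ≤ m) (i : ℕ) :
    HomologicalComplex.homologyMap (transitionHom a h) (i + 1) = 0 ↔
      ∀ x, d (fun j => a j ^ m) i x = 0 →
        ∃ y, d (fun j => a j ^ n) (i + 1) y = transition a m n (i + 1) x := by
  rw [homologyMap_eq_zero_iff, complex_d, complex_d]
  rfl

lemma transition_comp_transition {k m n : ℕ} (h : n ≤ m) (h' : m ≤ k) (i : ℕ) :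
    transition a m n i ∘ₗ transition a k m i = transition a k n i := by
  refine Finsupp.lhom_ext' fun s => LinearMap.ext_ring ?_
  simp only [LinearMap.comp_apply, Finsupp.lsingle_apply, Cech.transition_single, map_smul,
    smul_smul, ← pow_add]
  congr 2
  omega

end Koszul

namespace Cech

lemma exactAt_complex_iff (M : ModuleCat.{u} A) (i : ℕ) :
    (complex a M).ExactAt (i + 1) ↔
      ∀ z, (d a (i + 1)).rTensor M z = 0 → ∃ y, (d a i).rTensor M y = z := by
  rw [(complex a M).exactAt_iff' i (i + 1) (i + 1 + 1) (by simp) (by simp),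
    ShortComplex.moduleCat_exact_iff]
  change (∀ z, (complex a M).d (i + 1) (i + 1 + 1) z = 0 →
    ∃ y, (complex a M).d i (i + 1) y = z) ↔ _
  rw [complex_d, complex_d]
  rfl

variable {M : Type u} [AddCommGroup M] [Module A M]

/-- A Koszul cochain representing a Čech cocycle need not be a cocycle, but its coboundary is zero
in the colimit, hence zero at a later level. -/
lemma exists_comp_d_comp_transition_eq_zero (n i : ℕ) (φ : Koszul.Obj A r i →ₗ[A] M)
    (h : (d a i).rTensor M (ofKoszul a n i M φ) = 0) :
    ∃ m, n ≤ m ∧ (φ ∘ₗ Koszul.transition a m n i) ∘ₗ Koszul.d (fun j => a j ^ m) i = 0 := by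
  rw [d_ofKoszul] at h
  have h' : ofKoszul a n (i + 1) M (φ ∘ₗ Koszul.d (fun j => a j ^ n) i) = 0 := by
    have := congrArg (((-1 : A) ^ i) • ·) h
    simpa [smul_smul, ← mul_pow] using this
  obtain ⟨m₀, hm₀⟩ := exists_comp_transition_eq_zero a n (i + 1) _ h'
  refine ⟨max m₀ n, le_max_right _ _, ?_⟩
  rw [LinearMap.comp_assoc, ← Koszul.transition_comm a (le_max_right m₀ n), ← LinearMap.comp_assoc]
  exact hm₀ _ (le_max_left _ _)

/-- Over a weakly proregular sequence, the Čech complex of an injective module is exact in positive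
degrees. -/
lemma exact_of_isWeaklyProregular (ha : IsWeaklyProregular a) [Module.Injective A M] (i : ℕ)
    (z : Obj a (i + 1) ⊗[A] M) (hz : (d a (i + 1)).rTensor M z = 0) :
    ∃ y, (d a i).rTensor M y = z := by
  by_cases hi : i + 1 ≤ r
  · obtain ⟨n₀, hn₀⟩ := exists_ofKoszul_eq a (i + 1) z
    -- The successor keeps the exponent positive, as weak proregularity requires.
    obtain ⟨φ, rfl⟩ := hn₀ (n₀ + 1) (by omega)
    obtain ⟨n, hn, hφ⟩ := exists_comp_d_comp_transition_eq_zero a _ _ φ hz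
    rw [← ofKoszul_transition a hn]
    generalize φ ∘ₗ Koszul.transition a n (n₀ + 1) (i + 1) = ψ at hφ ⊢
    obtain ⟨m, hm, h⟩ := ha (i + 1) (by omega) hi n (by omega)
    rw [Koszul.homologyMap_transition_eq_zero_iff] at h
    -- Cycles at level m become boundaries at level n, and the cocycle ψ kills boundaries.
    have hker : LinearMap.ker (Koszul.d (fun j => a j ^ m) i) ≤
        LinearMap.ker (ψ ∘ₗ Koszul.transition a m n (i + 1)) := fun x hx => by
      obtain ⟨y, hy⟩ := h x hx
      rw [LinearMap.mem_ker, LinearMap.comp_apply, ← hy]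
      exact LinearMap.congr_fun hφ y
    let f := Koszul.d (fun j => a j ^ m) i
    -- The quotient by ker f embeds in K_i(a^m) through f; injectivity of M extends the induced map
    -- along this embedding.
    obtain ⟨χ, hχ⟩ := Module.Injective.out ((LinearMap.ker f).liftQ f le_rfl)
      (LinearMap.ker_eq_bot.1 (Submodule.ker_liftQ_eq_bot _ _ _ le_rfl))
      ((LinearMap.ker f).liftQ (ψ ∘ₗ Koszul.transition a m n (i + 1)) hker)
    have hχ' : χ ∘ₗ f = ψ ∘ₗ Koszul.transition a m n (i + 1) :=
      LinearMap.ext fun x => hχ (Submodule.Quotient.mk x)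
    refine ⟨(-1 : A) ^ i • ofKoszul a m i M χ, ?_⟩
    rw [map_smul, d_ofKoszul, smul_smul, ← mul_pow, hχ', ofKoszul_transition a hm]
    simp
  · have : IsEmpty (Subsets r (i + 1)) := ⟨fun s => hi (by
      have := s.1.card_le_univ
      rwa [s.2, Fintype.card_fin] at this)⟩
    exact ⟨0, (components a (i + 1) M).injective (Subsingleton.elim _ _)⟩

/-- If the Čech complexes of injective modules are exact in positive degrees, then the sequence is
weakly proregular. -/
lemma isWeaklyProregular_of_exact
    (h : ∀ (J : ModuleCat.{u} A) [Injective J] (i : ℕ), (complex a J).ExactAt (i + 1)) :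
    IsWeaklyProregular a := by
  rintro (_ | i) hi - n -
  · omega
  -- This choice makes the kernel of φ exactly the boundaries at level n, so φ is a cocycle that
  -- detects boundaries.
  let Q : ModuleCat.{u} A :=
    ModuleCat.of A (Koszul.Obj A r (i + 1) ⧸ LinearMap.range (Koszul.d (fun j => a j ^ n) (i + 1)))
  let J := Injective.under Q
  let φ : Koszul.Obj A r (i + 1) →ₗ[A] J := (Injective.ι Q).hom ∘ₗ Submodule.mkQ _
  have hφ (x) (hx : φ x = 0) : ∃ y, Koszul.d (fun j => a j ^ n) (i + 1) y = x := by
    have : Function.Injective (Injective.ι Q).hom :=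
      (ModuleCat.mono_iff_injective (Injective.ι Q)).1 inferInstance
    exact (Submodule.Quotient.mk_eq_zero _).1 (this (hx.trans (map_zero _).symm))
  have hφd : φ ∘ₗ Koszul.d (fun j => a j ^ n) (i + 1) = 0 := LinearMap.ext fun y => by
    have : Submodule.mkQ (LinearMap.range (Koszul.d (fun j => a j ^ n) (i + 1)))
        (Koszul.d (fun j => a j ^ n) (i + 1) y) = 0 :=
      (Submodule.Quotient.mk_eq_zero _).2 ⟨y, rfl⟩
    exact (congrArg (Injective.ι Q).hom this).trans (map_zero _)
  obtain ⟨y, hy⟩ := (exactAt_complex_iff a J i).1 (h J i) (ofKoszul a n (i + 1) J φ)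
    (by rw [d_ofKoszul, hφd, map_zero, smul_zero])
  obtain ⟨m₀, hm₀⟩ := exists_ofKoszul_eq a i y
  obtain ⟨χ, hχ⟩ := hm₀ (max m₀ n) (le_max_left _ _)
  have hm : n ≤ max m₀ n := le_max_right _ _
  generalize max m₀ n = m at hm hχ
  -- φ and the coboundary of χ agree only as Čech cochains; they agree as Koszul cochains after
  -- passing to a further level k.
  have h0 : ofKoszul a m (i + 1) J (φ ∘ₗ Koszul.transition a m n (i + 1) -
      (-1 : A) ^ i • χ ∘ₗ Koszul.d (fun j => a j ^ m) i) = 0 := by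
    rw [map_sub, ofKoszul_transition a hm, map_smul, ← d_ofKoszul, hχ, hy, sub_self]
  obtain ⟨k₀, hk₀⟩ := exists_comp_transition_eq_zero a m (i + 1) _ h0
  have hk := hk₀ (max k₀ m) (le_max_left _ _)
  have hmk : m ≤ max k₀ m := le_max_right _ _
  generalize max k₀ m = k at hk hmk
  refine ⟨k, hm.trans hmk, (Koszul.homologyMap_transition_eq_zero_iff a _ i).2 fun x hx => ?_⟩
  refine hφ _ ?_
  have h1 := LinearMap.congr_fun hk x
  have h2 := LinearMap.congr_fun (Koszul.transition_comm a hmk i) x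
  rw [LinearMap.comp_apply, LinearMap.comp_apply, hx, map_zero] at h2
  have h3 : φ (Koszul.transition a m n (i + 1) (Koszul.transition a k m (i + 1) x)) -
      (-1 : A) ^ i • χ (Koszul.d (fun j => a j ^ m) i (Koszul.transition a k m (i + 1) x)) = 0 := h1
  -- The cycle x at level k maps to a cycle at level m, so the coboundary term vanishes on it.
  rw [h2, map_zero, smul_zero, sub_zero] at h3
  rw [← Koszul.transition_comp_transition a hm hmk]
  exact h3

end Cech

end

noncomputable section

/-! ### The zeroth Čech cohomology and exactness of the Čech complex functor -/

/-- The right side says that I lies in the radical of the annihilator of x; as I is finitely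
generated, some power of I then lies in the annihilator. -/
lemma LocalCoh.mem_gammaSubmodule_iff {A : Type u} [CommRing A] {r : ℕ} (a : Fin r → A)
    {M : Type u} [AddCommGroup M] [Module A M] (x : M) :
    x ∈ gammaSubmodule (Ideal.span (Set.range a)) M ↔ ∀ j, ∃ k, a j ^ k • x = 0 := by
  constructor
  · rintro ⟨n, hn⟩ j
    exact ⟨n, hn _ (Ideal.pow_mem_pow (Ideal.subset_span (Set.mem_range_self j)) n)⟩
  · intro h
    have hle : Ideal.span (Set.range a) ≤ (Ideal.torsionOf A M x).radical := by
      rw [Ideal.span_le]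
      rintro _ ⟨j, rfl⟩
      obtain ⟨k, hk⟩ := h j
      exact ⟨k, (Ideal.mem_torsionOf_iff x _).2 hk⟩
    obtain ⟨n, hn⟩ := Ideal.exists_pow_le_of_le_radical_of_fg hle
      (Submodule.fg_span (Set.finite_range a))
    exact ⟨n, fun b hb => (Ideal.mem_torsionOf_iff x b).1 (hn hb)⟩

namespace Cech

variable {A : Type u} [CommRing A] {r : ℕ} (a : Fin r → A)

section Augmentation

variable (M : Type u) [AddCommGroup M] [Module A M]

/-- The augmentation `M → C^0(a) ⊗ M`. -/
def augmentation : M →ₗ[A] Obj a 0 ⊗[A] M := TensorProduct.mk A (Obj a 0) M 1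

variable {M}

lemma augmentation_injective : Function.Injective (augmentation a M) := by
  rw [← LinearMap.ker_eq_bot, LinearMap.ker_eq_bot']
  intro x hx
  have h : frac a ∅ 0 x = 0 := by
    have := congrFun (congrArg (components a 0 M) hx) ⟨∅, rfl⟩
    rw [map_zero] at this
    rw [frac, pow_zero]
    exact this
  obtain ⟨k, hk⟩ := exists_pow_smul_eq_zero a ∅ 0 x h
  rwa [Finset.prod_empty, one_pow, one_smul] at hk

/-- The only component of C^0 is the localization at the empty product 1, where denominators are
trivial. -/
lemma augmentation_surjective : Function.Surjective (augmentation a M) := by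
  intro z
  obtain ⟨n, hn⟩ := exists_frac_eq a ∅ (components a 0 M z ⟨∅, rfl⟩)
  obtain ⟨x, hx⟩ := hn n le_rfl
  refine ⟨x, (components a 0 M).injective (funext fun ⟨s, hs⟩ => ?_)⟩
  obtain rfl := Finset.card_eq_zero.1 hs
  have h : (∏ j ∈ (∅ : Finset (Fin r)), a j) ^ n = 1 := by rw [Finset.prod_empty, one_pow]
  refine ((pow_smul_frac a ∅ n x).symm.trans ?_).trans hx
  exact (congrArg (· • frac a ∅ n x) h).trans (one_smul A _)

lemma d_augmentation_eq_zero_iff (x : M) :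
    (d a 0).rTensor M (augmentation a M x) = 0 ↔
      x ∈ LocalCoh.gammaSubmodule (Ideal.span (Set.range a)) M := by
  -- The component at {j} is x / 1 in the localization at a_j, which is zero exactly when a power of
  -- a_j kills x.
  have hd (j : Fin r) : components a 1 M ((d a 0).rTensor M (augmentation a M x))
      ⟨{j}, Finset.card_singleton j⟩ = frac a {j} 0 x := by
    rw [components_d, Fintype.sum_eq_single ⟨j, Finset.mem_singleton_self j⟩]
    · have h0 : countAbove {j} j = 0 := by simp [countAbove]
      rw [h0, pow_zero, one_smul, augmentation, TensorProduct.mk_apply, components_tmul,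
        LinearMap.rTensor_tmul, frac, pow_zero]
      exact congrArg (· ⊗ₜ[A] x) (map_one (res a
        (Subsets.erase_subset ⟨{j}, Finset.card_singleton j⟩ ⟨j, Finset.mem_singleton_self j⟩)))
    · rintro ⟨k, hk⟩ hkj
      exact absurd (Subtype.ext (Finset.mem_singleton.1 hk)) hkj
  rw [LocalCoh.mem_gammaSubmodule_iff]
  constructor
  · intro h j
    have := hd j
    rw [h, map_zero] at this
    simpa using exists_pow_smul_eq_zero a {j} 0 x this.symm
  · intro h
    refine (components a 1 M).injective (funext fun ⟨t, ht⟩ => ?_)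
    obtain ⟨j, rfl⟩ := Finset.card_eq_one.1 ht
    obtain ⟨k, hk⟩ := h j
    have hk' : (∏ l ∈ {j}, a l) ^ k • x = 0 := by rw [Finset.prod_singleton, hk]
    rw [map_zero]
    refine (hd j).trans ((frac_add a {j} 0 k x).symm.trans ?_)
    rw [hk', map_zero]
    rfl

end Augmentation

/-- The inclusion `Γ_I(M) ⟶ C^0(a) ⊗ M`. -/
def gammaToComplex (M : ModuleCat.{u} A) :
    (LocalCoh.gammaFunctor (Ideal.span (Set.range a))).obj M ⟶ (complex a M).X 0 :=
  ModuleCat.ofHom (augmentation a M ∘ₗ Submodule.subtype _)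

lemma gammaToComplex_d (M : ModuleCat.{u} A) :
    gammaToComplex a M ≫ (complex a M).d 0 1 = 0 := by
  rw [complex_d]
  ext x
  exact (d_augmentation_eq_zero_iff a x.1).2 x.2

lemma gammaToComplex_naturality {M N : ModuleCat.{u} A} (f : M ⟶ N) :
    (LocalCoh.gammaFunctor (Ideal.span (Set.range a))).map f ≫ gammaToComplex a N =
      gammaToComplex a M ≫ ((complexFunctor a).map f).f 0 := rfl

/-- The map `Γ_I(M) ⟶ Z^0(C(a) ⊗ M)`. -/
def gammaToCycles (M : ModuleCat.{u} A) :
    (LocalCoh.gammaFunctor (Ideal.span (Set.range a))).obj M ⟶ (complex a M).cycles 0 :=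
  (complex a M).liftCycles (gammaToComplex a M) 1 (by simp) (gammaToComplex_d a M)

lemma gammaToCycles_iCycles (M : ModuleCat.{u} A) :
    gammaToCycles a M ≫ (complex a M).iCycles 0 = gammaToComplex a M :=
  HomologicalComplex.liftCycles_i _ _ _ _ _

lemma gammaToCycles_naturality {M N : ModuleCat.{u} A} (f : M ⟶ N) :
    (LocalCoh.gammaFunctor (Ideal.span (Set.range a))).map f ≫ gammaToCycles a N =
      gammaToCycles a M ≫ HomologicalComplex.cyclesMap ((complexFunctor a).map f) 0 :=
  RightDerivedComparison.comp_lift_of_mono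
    (inferInstanceAs (Mono ((complex a N).iCycles 0))) (gammaToCycles_iCycles a M)
    (gammaToCycles_iCycles a N) (HomologicalComplex.cyclesMap_i ((complexFunctor a).map f) 0)
    (gammaToComplex_naturality a f)

instance isIso_gammaToCycles (M : ModuleCat.{u} A) : IsIso (gammaToCycles a M) := by
  rw [gammaToCycles, CochainComplex.isIso_liftCycles_iff]
  constructor
  · rw [ShortComplex.moduleCat_exact_iff]
    intro z hz
    obtain ⟨x, rfl⟩ := augmentation_surjective a z
    refine ⟨⟨x, (d_augmentation_eq_zero_iff a x).1 ?_⟩, rfl⟩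
    change (complex a M).d 0 1 _ = 0 at hz
    rw [complex_d] at hz
    exact hz
  · exact (ModuleCat.mono_iff_injective _).2
      ((augmentation_injective a).comp Subtype.val_injective)

/-- `Ȟ^0(a, -)` is the torsion functor. -/
def gammaIso : LocalCoh.gammaFunctor (Ideal.span (Set.range a)) ≅
    RightDerivedComparison.zeroth (complexFunctor a) :=
  NatIso.ofComponents
    (fun M => asIso (gammaToCycles a M) ≪≫ (complex a M).isoHomologyπ₀)
    (fun f => RightDerivedComparison.comp_two_squares (gammaToCycles_naturality a f)
      (HomologicalComplex.homologyπ_naturality ((complexFunctor a).map f) 0).symm)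

instance additive_complexFunctor : (complexFunctor a).Additive where
  map_add {_ _ f g} := HomologicalComplex.hom_ext _ _ fun i =>
    congrArg ModuleCat.ofHom (LinearMap.lTensor_add (Obj a i) f.hom g.hom)

instance flat_obj (i : ℕ) : Module.Flat A (Obj a i) :=
  Module.Flat.of_linearEquiv
    (DFinsupp.linearEquivFunOnFintype (R := A) (M := fun s : Subsets r i => Loc a s.1)).symm

lemma shortExact_map_complexFunctor (S : ShortComplex (ModuleCat.{u} A)) (hS : S.ShortExact) :
    (S.map (complexFunctor a)).ShortExact := by
  refine HomologicalComplex.shortExact_of_degreewise_shortExact _ fun i => ?_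
  have h := (ShortComplex.ShortExact.moduleCat_exact_iff_function_exact S).1 hS.exact
  exact
    { exact := (ShortComplex.ShortExact.moduleCat_exact_iff_function_exact _).2
        (Module.Flat.lTensor_exact (Obj a i) h)
      mono_f := (ModuleCat.mono_iff_injective _).2
        (Module.Flat.lTensor_preserves_injective_linearMap S.f.hom hS.moduleCat_injective_f)
      epi_g := (ModuleCat.epi_iff_surjective _).2
        (LinearMap.lTensor_surjective (Obj a i) hS.moduleCat_surjective_g) }

/-- If the Čech complex of every injective module is exact in positive degrees, then Čech cohomology
is local cohomology. -/
lemma nonempty_iso_of_exactAt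
    (h : ∀ (J : ModuleCat.{u} A) [Injective J] (i : ℕ), (complex a J).ExactAt (i + 1)) (i : ℕ) :
    Nonempty (LocalCoh.H (Ideal.span (Set.range a)) i ≅ H a i) := by
  obtain ⟨e⟩ := RightDerivedComparison.nonempty_rightDerived_iso (complexFunctor a)
    (shortExact_map_complexFunctor a) (fun J _ i => (h J i).isZero_homology) i
  have h₁ : NatTrans.rightDerived (gammaIso a).hom i ≫ NatTrans.rightDerived (gammaIso a).inv i =
      𝟙 _ := by
    rw [← NatTrans.rightDerived_comp, Iso.hom_inv_id, NatTrans.rightDerived_id]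
  have h₂ : NatTrans.rightDerived (gammaIso a).inv i ≫ NatTrans.rightDerived (gammaIso a).hom i =
      𝟙 _ := by
    rw [← NatTrans.rightDerived_comp, Iso.inv_hom_id, NatTrans.rightDerived_id]
  exact ⟨Iso.trans ⟨_, _, h₁, h₂⟩ e⟩

lemma exactAt_of_isWeaklyProregular (ha : IsWeaklyProregular a) (J : ModuleCat.{u} A)
    [Injective J] (i : ℕ) : (complex a J).ExactAt (i + 1) := by
  have : Module.Injective A J := Module.injective_module_of_injective_object A J
  exact (exactAt_complex_iff a J i).2 (exact_of_isWeaklyProregular a ha i)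

end Cech

/-- A sequence `a` generating `I` is weakly proregular if and only if `H^i_I(M) ≅ Ȟ^i(a, M)` for
all `i` and `M`; moreover, for a weakly proregular `a` the isomorphisms can be chosen functorial
in `M`. -/
theorem mainTheorem1 {A : Type u} [CommRing A] {r : ℕ} (a : Fin r → A) :
    (IsWeaklyProregular a ↔
      ∀ (i : ℕ) (M : ModuleCat.{u} A),
        Nonempty ((LocalCoh.H (Ideal.span (Set.range a)) i).obj M ≅ (Cech.H a i).obj M)) ∧
    (IsWeaklyProregular a →
      ∀ i : ℕ, Nonempty (LocalCoh.H (Ideal.span (Set.range a)) i ≅ Cech.H a i)) := by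
  have h (ha : IsWeaklyProregular a) (i : ℕ) :
      Nonempty (LocalCoh.H (Ideal.span (Set.range a)) i ≅ Cech.H a i) :=
    Cech.nonempty_iso_of_exactAt a (Cech.exactAt_of_isWeaklyProregular a ha) i
  refine ⟨⟨fun ha i M => ?_, fun hiso => ?_⟩, h⟩
  · obtain ⟨e⟩ := h ha i
    exact ⟨e.app M⟩
  · refine Cech.isWeaklyProregular_of_exact a fun J _ i => ?_
    -- Only injective modules in positive degrees are tested; there local cohomology vanishes, so
    -- Čech cohomology does too.
    obtain ⟨e⟩ := hiso (i + 1) J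
    exact ((Cech.complex a J).exactAt_iff_isZero_homology (i + 1)).2
      (((LocalCoh.gammaFunctor _).isZero_rightDerived_obj_injective_succ i J).of_iso e.symm)

end
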